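/- Consider $N\ge 1$ users, $p\in(0,1]$, $q\in(0,1]$, a fetching cost $C_f\ge 0$ and an age cost $C_a:\{0,1,2,\dots\}\to[0,\infty)$ that is (strictly) increasing and convex. Put $B(n,r,k)=\binom nk r^k(1-r)^{n-k}$, $\bar C(\tau)=\sum_{v=0}^{\tau}B(\tau,p,v)C_a(v)$ and $\beta=1-(1-q)^N$. *The control problem.* The state is $(\tau,m)$ with $\tau\in\{1,2,\dots\}$ and $m\in\{0,\dots,N\}$. In every slot one chooses, as a possibly randomized function of the past and of the current state, to fetch (cost $C_f$; next state $(1,M)$) or not to fetch (cost $m\bar C(\tau)$; next state $(\tau+1,M)$), where $M\sim\mathrm{Binomial}(N,q)$ is drawn independently in every slot. A number $\theta$ is the *optimal average cost* if, for every initial state, no policy has a long-run average expected cost (even as a lower limit) below $\theta$, and some policy has average expected cost converging to $\theta$. *The map $f$.* For $\theta\in\mathbb R$ let $\bar\tau(1)=\min\{\tau\ge 1:\bar C(\tau)\ge\theta/\beta\}$, that is, the rounded-up inverse $\lceil\bar C^{-1}(\theta/\beta)\rceil$ as a time in $\{1,2,\dots\}$, and put $\bar g(\bar\tau(1))=C_f-\theta/\beta$.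 Start with $m=1$, $\tau=\bar\tau(1)$, and while $\tau>1$ repeat: 1. while $\bar g(\tau)\le C_f-(m+1)\bar C(\tau-1)$ and $m<N$, increase $m$ by $1$ and then set $\bar\tau(m)=\tau$; 2. if $\tau>2$, set $\bar g(\tau-1)=C_f-\theta+\sum_{k\le m}B(N,q,k)\bigl(k\bar C(\tau-1)-C_f+\bar g(\tau)\bigr)$; otherwise set $\bar\tau(m+1)=\dots=\bar\tau(N)=1$; 3. decrease $\tau$ by $1$. Then $f(\theta)=N\bar C(1)q+\bar g(2)$ if $\bar\tau(N)>1$, and $f(\theta)=\sum_{k\le m}B(N,q,k)\bigl(k\bar C(1)+\bar g(2)\bigr)+\sum_{m<k\le N}B(N,q,k)C_f$ otherwise. If $\bar\tau(1)=1$, so that the loop is not entered, put $\bar g(2)=C_f-\theta/\beta$ and use the last formula with $m=0$. **Theorem.** The quantity $\bar g(2)$ and the map $f$ are non-increasing functions of $\theta\in\mathbb R$. There is exactly one $\theta\in\mathbb R$ with $f(\theta)=\theta$, and a number $\theta$ is a fixed point of $f$ if and only if it is the optimal average cost $\bar\theta$ of the control problem. -/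

import Mathlib

open Filter Topology

noncomputable section

namespace ContentFetching

/-- The binomial weight `B(n, r, k) = C(n, k) r ^ k (1 - r) ^ (n - k)`. -/
def B (n : ℕ) (r : ℝ) (k : ℕ) : ℝ := (n.choose k : ℝ) * r ^ k * (1 - r) ^ (n - k)

/-- The data of the homogeneous content fetching and broadcast problem: `N` users, update
probability `p`, request probability `q`, fetching cost `Cf`, and age cost `Ca` as a function of the
version age, which is nonnegative, increasing and convex on `{0, 1, 2, …}`. -/
structure Model where
  N : ℕ
  p : ℝ
  q : ℝ
  Cf : ℝ
  Ca : ℕ → ℝ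
  N_pos : 0 < N
  p_pos : 0 < p
  p_le_one : p ≤ 1
  q_pos : 0 < q
  q_le_one : q ≤ 1
  Cf_nonneg : 0 ≤ Cf
  Ca_nonneg : ∀ v, 0 ≤ Ca v
  Ca_strictMono : StrictMono Ca
  Ca_convex : ∀ v, Ca (v + 1) - Ca v ≤ Ca (v + 2) - Ca (v + 1)

namespace Model

variable (M : Model)

/-- Expected age cost `E[Ca(V)]` of a requesting user, where `V ~ Binomial(τ, p)`. -/
def Cav (τ : ℕ) : ℝ := ∑ v ∈ Finset.range (τ + 1), B τ M.p v * M.Ca v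

/-! ### The Markov decision process and its optimal average cost -/

/-- A state `(τ, m)`: time since the last fetch, and number of requests, `0 ≤ m ≤ N`.
The states of the process are those with `1 ≤ τ`. -/
abbrev State : Type := ℕ × Fin (M.N + 1)

/-- Expected single stage cost; the action `true` is "fetch and broadcast". -/
def stageCost (s : M.State) (a : Bool) : ℝ :=
  if a then M.Cf else ((s.2 : ℕ) : ℝ) * M.Cav s.1

lemma sum_B_eq_one :
    ∑ k : Fin (M.N + 1), ENNReal.ofReal (B M.N M.q k) = 1 := by
  rw [← ENNReal.ofReal_sum_of_nonneg]
  · rw [Fin.sum_univ_eq_sum_range (fun k => B M.N M.q k)]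
    have h := add_pow M.q (1 - M.q) M.N
    have h2 : ∑ k ∈ Finset.range (M.N + 1), B M.N M.q k = 1 := by
      have h3 : M.q + (1 - M.q) = 1 := by ring
      rw [h3, one_pow] at h
      rw [h]
      exact Finset.sum_congr rfl fun k _ => by unfold B; ring
    rw [h2, ENNReal.ofReal_one]
  · intro k _
    have h1 := M.q_pos
    have h2 : 0 ≤ 1 - M.q := sub_nonneg.mpr M.q_le_one
    unfold B
    positivity

/-- The law `Binomial(N, q)` of the number of requests in a slot. -/
def requestLaw : PMF (Fin (M.N + 1)) :=
  PMF.ofFintype (fun k => ENNReal.ofReal (B M.N M.q k)) M.sum_B_eq_one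

/-- Past states and actions, most recent first. -/
abbrev Past : Type := List (M.State × Bool)

/-- A (randomized, history dependent) policy: the law of the action, given the past and the current
state. -/
abbrev Policy : Type := M.Past → M.State → PMF Bool

/-- Law of the past and the current state after `t` slots, from the initial state `s₀`, under `π`:
the new number of requests is drawn from `Binomial(N, q)`, and `τ` becomes `1` after a fetch and
`τ + 1` otherwise. -/
def historyLaw (π : M.Policy) (s₀ : M.State) : ℕ → PMF (M.Past × M.State)
  | 0 => PMF.pure ([], s₀)
  | t + 1 => (historyLaw π s₀ t).bind fun x =>
      (π x.1 x.2).bind fun a =>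
        M.requestLaw.map fun k => ((x.2, a) :: x.1, (if a then 1 else x.2.1 + 1, k))

/-- Joint law of the state and the action in slot `t` (slots are numbered from `0`). -/
def stateActionLaw (π : M.Policy) (s₀ : M.State) (t : ℕ) : PMF (M.State × Bool) :=
  (M.historyLaw π s₀ t).bind fun x => (π x.1 x.2).map fun a => (x.2, a)

/-- Expected cost in slot `t`. The law has finite support, so that this is a finite sum. -/
def expectedCost (π : M.Policy) (s₀ : M.State) (t : ℕ) : ℝ :=
  ∑' y : M.State × Bool, (M.stateActionLaw π s₀ t y).toReal * M.stageCost y.1 y.2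

/-- Expected average cost per slot over the first `T` slots. -/
def averageCost (π : M.Policy) (s₀ : M.State) (T : ℕ) : ℝ :=
  (∑ t ∈ Finset.range T, M.expectedCost π s₀ t) / T

/-- `θ` is the optimal (minimal) long-run average expected cost, from every initial state: no policy
has a smaller one, even in the sense of the lower limit, and some policy has average cost `θ`, as a
limit. -/
def IsOptimalAverageCost (θ : ℝ) : Prop :=
  ∀ s₀ : M.State, 1 ≤ s₀.1 →
    (∀ π : M.Policy,
      (θ : EReal) ≤ liminf (fun T : ℕ => ((M.averageCost π s₀ T : ℝ) : EReal)) atTop) ∧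
    ∃ π : M.Policy, Tendsto (M.averageCost π s₀) atTop (𝓝 θ)

/-! ### The algorithm -/

/-- Probability `1 - (1 - q) ^ N` of at least one request in a slot. -/
def anyRequest : ℝ := 1 - (1 - M.q) ^ M.N

/-- The threshold `τ̄(1) = ⌈Cav⁻¹(θ / (1 - (1 - q) ^ N))⌉`, as a time in `{1, 2, …}`: the first `τ`
with `Cav τ ≥ θ / (1 - (1 - q) ^ N)`. -/
def tauOne (θ : ℝ) : ℕ := sInf {τ : ℕ | 1 ≤ τ ∧ θ / M.anyRequest ≤ M.Cav τ}

/-- `tauOne` is the rounded-up inverse, for every increasing extension `c` of `Cav` to real times. -/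
lemma tauOne_eq_ceil (c : ℝ → ℝ) (hc : StrictMonoOn c (Set.Ici 0))
    (hext : ∀ τ : ℕ, 1 ≤ τ → c τ = M.Cav τ) (θ y : ℝ) (hy : 0 ≤ y)
    (hcy : c y = θ / M.anyRequest) : M.tauOne θ = max 1 ⌈y⌉₊ := by
  have key : ∀ τ : ℕ, 1 ≤ τ → (θ / M.anyRequest ≤ M.Cav τ ↔ y ≤ τ) := fun τ h => by
    rw [← hcy, ← hext τ h]
    exact hc.le_iff_le (Set.mem_Ici.mpr hy) (Set.mem_Ici.mpr (Nat.cast_nonneg τ))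
  refine IsLeast.csInf_eq ⟨⟨le_max_left _ _, ?_⟩, ?_⟩
  · exact (key _ (le_max_left _ _)).mpr
      ((Nat.le_ceil y).trans (Nat.cast_le.mpr (le_max_right _ _)))
  · rintro τ ⟨h1, h2⟩
    exact max_le h1 (Nat.ceil_le.mpr ((key τ h1).mp h2))

/-- The value `Cf - θ / (1 - (1 - q) ^ N)`, which `ḡ(τ)` has for all `τ ≥ τ̄(1)`. -/
def gTop (θ : ℝ) : ℝ := M.Cf - θ / M.anyRequest

/-- The variables of the algorithm other than `τ`: the counter `m`, the thresholds `τ̄(·)` and the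
values `ḡ(·)`. -/
structure Vars where
  m : ℕ
  tau : ℕ → ℕ
  g : ℕ → ℝ

open Classical in
/-- The inner loop:
`while ḡ(τ) ≤ Cf - (m + 1) Cav(τ - 1) and m < N do { m ← m + 1; τ̄(m) ← τ }`. -/
def innerLoop (τ : ℕ) (s : Vars) : Vars :=
  if s.g τ ≤ M.Cf - ((s.m : ℝ) + 1) * M.Cav (τ - 1) ∧ s.m < M.N then
    innerLoop τ { s with m := s.m + 1, tau := Function.update s.tau (s.m + 1) τ }
  else s
termination_by M.N - s.m

/-- What the body of the outer loop does after the inner loop: compute `ḡ(τ - 1)` if `τ > 2`, and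
set `τ̄(m + 1) = … = τ̄(N) = 1` otherwise. -/
def updateStep (θ : ℝ) (τ : ℕ) (s : Vars) : Vars :=
  if 2 < τ then
    { s with g := Function.update s.g (τ - 1) (M.Cf - θ +
        ∑ k ∈ Finset.range (s.m + 1),
          B M.N M.q k * ((k : ℝ) * M.Cav (τ - 1) - M.Cf + s.g τ)) }
  else
    { s with tau := fun j => if s.m + 1 ≤ j ∧ j ≤ M.N then 1 else s.tau j }

/-- The outer loop: `while τ > 1 do { inner loop; update; τ ← τ - 1 }`. -/
def outerLoop (θ : ℝ) (τ : ℕ) (s : Vars) : Vars :=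
  if 1 < τ then outerLoop θ (τ - 1) (M.updateStep θ τ (M.innerLoop τ s)) else s
termination_by τ

/-- The variables when the loops, started at `m = 1` and `τ = τ̄(1)`, have ended. Values that have
not been assigned yet are `0` and are never read. -/
def finalVars (θ : ℝ) : Vars :=
  M.outerLoop θ (M.tauOne θ)
    { m := 1
      tau := Function.update (fun _ => 0) 1 (M.tauOne θ)
      g := Function.update (fun _ => 0) (M.tauOne θ) (M.gTop θ) }

/-- The value `ḡ(2)`. If `τ̄(1) = 1` then the loops are not entered, and `ḡ(2)` is the common value
of `ḡ` at all times from `τ̄(1)` on. -/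
def gTwo (θ : ℝ) : ℝ := if M.tauOne θ = 1 then M.gTop θ else (M.finalVars θ).g 2

/-- The map `f` computed by the algorithm. If `τ̄(1) = 1` (loops not entered), then all thresholds
are `1`, so that a fetch takes place at `τ = 1` exactly when there is at least one request. -/
def f (θ : ℝ) : ℝ :=
  if M.tauOne θ = 1 then
    B M.N M.q 0 * M.gTwo θ + ∑ k ∈ Finset.Icc 1 M.N, B M.N M.q k * M.Cf
  else if 1 < (M.finalVars θ).tau M.N then
    (M.N : ℝ) * M.Cav 1 * M.q + M.gTwo θ
  else
    ∑ k ∈ Finset.range ((M.finalVars θ).m + 1),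
        B M.N M.q k * ((k : ℝ) * M.Cav 1 + M.gTwo θ)
      + ∑ k ∈ Finset.Ioc (M.finalVars θ).m M.N, B M.N M.q k * M.Cf

end Model

end ContentFetching

end

/-!
The algorithm computes, backwards in `τ`, a solution `g` of the average cost optimality equation.
Writing `Φ c x` for the expectation, over the number `k` of requests, of `min Cf (k c + x)` (and of
`x` if `k = 0`), the recursion is `g τ = Φ (Cav τ) (g (τ + 1)) - θ`. The constant `gTop θ` satisfies
it as soon as `θ / anyRequest ≤ Cav τ`, hence for all `τ ≥ tauOne θ`, and this is where the backward
recursion starts (`relValue`, `relValue_bellman`). Induction from there shows that `g` is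
non-decreasing in `τ`, non-increasing in `θ` and continuous in `θ`. Monotonicity in `τ`, together
with that of `Cav`, is what makes the single increasing counter `m` of the algorithm find the
minimizing threshold at every time (`innerLoop_spec`, `outerLoop_finalSpec`), so that
`gTwo θ = g 2` and `f θ = Φ (Cav 1) (g 2)` in all branches of the definition of `f`.

Hence `gTwo` and `f` are non-increasing and `f` is continuous. As `f 0 = Cf ≥ 0` and
`f Cf ≤ f 0 = Cf`, there is a fixed point in `[0, Cf]`, and only one since `f` is non-increasing.

If `f θ = θ` then `g 1 = Φ (Cav 1) (g 2) - θ = 0`, and `θ ≥ 0` gives `g ≤ gTop θ ≤ Cf`. So the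
relative cost `h (τ, m) = min Cf (m Cav τ + g (τ + 1))` lies in `[0, Cf]`, and
`h s ≤ cost + g (next time)` for each action, with equality for the greedy one
(`stateValue_le`, `stateValue_eq_greedy`). Since the expectation of `h` over a new number of requests
is `g + θ`, summation over the first `T` slots telescopes: the expected total cost of every policy is
at least `T θ - Cf`, and that of the greedy policy at most `T θ + Cf`. So `θ` is the optimal average
cost, and the converse holds because the optimal average cost is unique.
-/

namespace ContentFetching

/-! ### Binomial averages -/

lemma B_nonneg {r : ℝ} (h0 : 0 ≤ r) (h1 : r ≤ 1) (n k : ℕ) : 0 ≤ B n r k := by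
  have := sub_nonneg.mpr h1
  unfold B
  positivity

/-- Conditioning a `Binomial(n + 1, r)` variable on its last trial. -/
lemma sum_B_succ (n : ℕ) (r : ℝ) (φ : ℕ → ℝ) :
    ∑ v ∈ Finset.range (n + 2), B (n + 1) r v * φ v =
      (1 - r) * ∑ v ∈ Finset.range (n + 1), B n r v * φ v +
        r * ∑ v ∈ Finset.range (n + 1), B n r v * φ (v + 1) := by
  have hz : B n r (n + 1) = 0 := by simp [B]
  have h0 : B (n + 1) r 0 = (1 - r) * B n r 0 := by simp [B, pow_succ]; ring
  have hs : ∀ v ∈ Finset.range (n + 1),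
      B (n + 1) r (v + 1) = (1 - r) * B n r (v + 1) + r * B n r v := by
    intro v hv
    rw [Finset.mem_range] at hv
    rcases Nat.lt_or_ge v n with h | h
    · obtain ⟨d, rfl⟩ : ∃ d, n = v + 1 + d := ⟨n - (v + 1), by omega⟩
      have e1 : v + 1 + d + 1 - (v + 1) = d + 1 := by omega
      have e2 : v + 1 + d - (v + 1) = d := by omega
      have e3 : v + 1 + d - v = d + 1 := by omega
      simp only [B, e1, e2, e3, Nat.choose_succ_succ' (v + 1 + d) v]
      push_cast
      ring
    · obtain rfl : v = n := by omega
      rw [hz]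
      simp [B]
      ring
  rw [Finset.sum_range_succ', Finset.sum_congr rfl fun v hv => by rw [hs v hv], h0]
  have hsplit : ∑ v ∈ Finset.range (n + 1), B n r v * φ v =
      ∑ v ∈ Finset.range (n + 1), B n r (v + 1) * φ (v + 1) + B n r 0 * φ 0 := by
    rw [← Finset.sum_range_succ' (fun v => B n r v * φ v), Finset.sum_range_succ _ (n + 1), hz]
    ring
  rw [hsplit, mul_add, Finset.mul_sum, Finset.mul_sum, add_right_comm, ← Finset.sum_add_distrib]
  congr 1
  · exact Finset.sum_congr rfl fun v _ => by ring
  · ring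

lemma sum_B (n : ℕ) (r : ℝ) : ∑ v ∈ Finset.range (n + 1), B n r v = 1 := by
  induction n with
  | zero => simp [B]
  | succ n ih =>
    have h := sum_B_succ n r fun _ => 1
    simp only [mul_one, ih] at h
    rw [h]
    ring

lemma sum_B_mul_id (n : ℕ) (r : ℝ) : ∑ v ∈ Finset.range (n + 1), B n r v * (v : ℝ) = n * r := by
  induction n with
  | zero => simp [B]
  | succ n ih =>
    rw [sum_B_succ n r fun v => (v : ℝ)]
    simp only [Nat.cast_succ, mul_add, mul_one, Finset.sum_add_distrib, ih, sum_B]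
    ring

namespace Model

variable (M : Model)

lemma B_request_nonneg (k : ℕ) : 0 ≤ B M.N M.q k := B_nonneg M.q_pos.le M.q_le_one _ _

lemma anyRequest_pos : 0 < M.anyRequest := by
  have h : (1 - M.q) ^ M.N < 1 :=
    pow_lt_one₀ (sub_nonneg.mpr M.q_le_one) (by linarith [M.q_pos]) M.N_pos.ne'
  unfold anyRequest
  linarith

lemma B_request_zero : B M.N M.q 0 = 1 - M.anyRequest := by simp [B, anyRequest]

/-! ### The expected age cost -/

lemma Ca_increment (v : ℕ) : M.Ca 1 - M.Ca 0 ≤ M.Ca (v + 1) - M.Ca v := by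
  induction v with
  | zero => simp
  | succ v ih => exact ih.trans (M.Ca_convex v)

/-- By convexity the expected age cost grows at least linearly. -/
lemma Cav_add_le_succ (τ : ℕ) : M.Cav τ + M.p * (M.Ca 1 - M.Ca 0) ≤ M.Cav (τ + 1) := by
  have h : M.Ca 1 - M.Ca 0 ≤
      ∑ v ∈ Finset.range (τ + 1), B τ M.p v * (M.Ca (v + 1) - M.Ca v) := by
    calc M.Ca 1 - M.Ca 0
        = ∑ v ∈ Finset.range (τ + 1), B τ M.p v * (M.Ca 1 - M.Ca 0) := by
          rw [← Finset.sum_mul, sum_B, one_mul]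
      _ ≤ _ := Finset.sum_le_sum fun v _ =>
          mul_le_mul_of_nonneg_left (M.Ca_increment v) (B_nonneg M.p_pos.le M.p_le_one _ _)
  simp only [mul_sub, Finset.sum_sub_distrib] at h
  unfold Cav
  rw [sum_B_succ τ M.p M.Ca]
  nlinarith [mul_le_mul_of_nonneg_left h M.p_pos.le]

lemma age_slope_pos : 0 < M.p * (M.Ca 1 - M.Ca 0) :=
  mul_pos M.p_pos (sub_pos.mpr (M.Ca_strictMono Nat.zero_lt_one))

lemma Cav_mono : Monotone M.Cav :=
  monotone_nat_of_le_succ fun τ => by linarith [M.Cav_add_le_succ τ, M.age_slope_pos]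

lemma Cav_nonneg (τ : ℕ) : 0 ≤ M.Cav τ :=
  Finset.sum_nonneg fun v _ =>
    mul_nonneg (B_nonneg M.p_pos.le M.p_le_one _ _) (M.Ca_nonneg v)

lemma exists_le_Cav (x : ℝ) : ∃ τ : ℕ, 1 ≤ τ ∧ x ≤ M.Cav τ := by
  have hlin : ∀ τ : ℕ, τ * (M.p * (M.Ca 1 - M.Ca 0)) ≤ M.Cav τ := by
    intro τ
    induction τ with
    | zero => simpa using M.Cav_nonneg 0
    | succ τ ih =>
      push_cast
      linarith [M.Cav_add_le_succ τ]
  obtain ⟨n, hn⟩ := exists_nat_ge (x / (M.p * (M.Ca 1 - M.Ca 0)))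
  refine ⟨n + 1, by omega, ?_⟩
  exact (((div_le_iff₀ M.age_slope_pos).mp hn).trans (hlin n)).trans (M.Cav_mono n.le_succ)

lemma tauOne_spec (θ : ℝ) : 1 ≤ M.tauOne θ ∧ θ / M.anyRequest ≤ M.Cav (M.tauOne θ) :=
  Nat.sInf_mem (M.exists_le_Cav (θ / M.anyRequest))

lemma tauOne_le_iff {θ : ℝ} {τ : ℕ} (hτ : 1 ≤ τ) :
    M.tauOne θ ≤ τ ↔ θ / M.anyRequest ≤ M.Cav τ :=
  ⟨fun h => (M.tauOne_spec θ).2.trans (M.Cav_mono h), fun h => Nat.sInf_le ⟨hτ, h⟩⟩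

lemma tauOne_mono : Monotone M.tauOne := fun _ θ' h =>
  (M.tauOne_le_iff (M.tauOne_spec θ').1).mpr
    ((div_le_div_of_nonneg_right h M.anyRequest_pos.le).trans (M.tauOne_spec θ').2)

lemma gTop_antitone : Antitone M.gTop := fun _ _ h =>
  sub_le_sub_left (div_le_div_of_nonneg_right h M.anyRequest_pos.le) _

/-! ### The Bellman recursion -/

/-- The minimal cost of a slot with `k` requests, when waiting costs `c` per request and leads to a
continuation cost `x`, and fetching costs `Cf` in total. Without a request one always waits, also
where `Cf < x`: this is what the algorithm does at negative `θ`. -/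
noncomputable def slotCost (c x : ℝ) (k : ℕ) : ℝ := if k = 0 then x else min M.Cf (k * c + x)

/-- The expectation of `slotCost` over the number of requests. -/
noncomputable def meanCost (c x : ℝ) : ℝ :=
  ∑ k ∈ Finset.range (M.N + 1), B M.N M.q k * M.slotCost c x k

lemma slotCost_mono {c c' x x' : ℝ} (hc : c ≤ c') (hx : x ≤ x') (k : ℕ) :
    M.slotCost c x k ≤ M.slotCost c' x' k := by
  unfold slotCost
  split_ifs
  · exact hx
  · gcongr

lemma meanCost_mono {c c' x x' : ℝ} (hc : c ≤ c') (hx : x ≤ x') :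
    M.meanCost c x ≤ M.meanCost c' x' :=
  Finset.sum_le_sum fun k _ =>
    mul_le_mul_of_nonneg_left (M.slotCost_mono hc hx k) (M.B_request_nonneg k)

lemma continuous_meanCost (c : ℝ) : Continuous (M.meanCost c) := by
  unfold meanCost
  refine continuous_finsetSum _ fun k _ => continuous_const.mul ?_
  unfold slotCost
  split_ifs <;> fun_prop

/-- If waiting is optimal for `1, …, m` requests and fetching for more, then `meanCost` splits at
`m`. -/
lemma meanCost_eq_of_threshold {c x : ℝ} {m : ℕ} (hm : m ≤ M.N)
    (hle : ∀ k : ℕ, 1 ≤ k → k ≤ m → k * c + x ≤ M.Cf)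
    (hgt : ∀ k : ℕ, m < k → k ≤ M.N → M.Cf ≤ k * c + x) :
    M.meanCost c x = ∑ k ∈ Finset.range (m + 1), B M.N M.q k * (k * c + x) +
      ∑ k ∈ Finset.Ioc m M.N, B M.N M.q k * M.Cf := by
  have hI : Finset.Ioc m M.N = Finset.Ico (m + 1) (M.N + 1) := by
    ext k; simp only [Finset.mem_Ioc, Finset.mem_Ico]; omega
  unfold meanCost
  rw [hI, Finset.range_eq_Ico, Finset.range_eq_Ico,
    ← Finset.sum_Ico_consecutive _ (Nat.zero_le (m + 1)) (Nat.succ_le_succ hm)]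
  congr 1
  · refine Finset.sum_congr rfl fun k hk => ?_
    rw [Finset.mem_Ico] at hk
    unfold slotCost
    split_ifs with h
    · simp [h]
    · rw [min_eq_right (hle k (by omega) (by omega))]
  · refine Finset.sum_congr rfl fun k hk => ?_
    rw [Finset.mem_Ico] at hk
    rw [slotCost, if_neg (by omega), min_eq_left (hgt k (by omega) (by omega))]

lemma sum_B_request_split {m : ℕ} (hm : m ≤ M.N) :
    ∑ k ∈ Finset.range (m + 1), B M.N M.q k + ∑ k ∈ Finset.Ioc m M.N, B M.N M.q k = 1 := by
  have hI : Finset.Ioc m M.N = Finset.Ico (m + 1) (M.N + 1) := by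
    ext k; simp only [Finset.mem_Ioc, Finset.mem_Ico]; omega
  rw [hI, Finset.range_eq_Ico,
    Finset.sum_Ico_consecutive _ (Nat.zero_le (m + 1)) (Nat.succ_le_succ hm),
    ← Finset.range_eq_Ico, sum_B]

/-- For `c ≥ 0` the threshold `m` is characterized by its own and the next number of requests, which
are the only ones that the inner loop compares. -/
lemma meanCost_eq_of_maximal {c x : ℝ} {m : ℕ} (hc : 0 ≤ c) (hm : m ≤ M.N)
    (hle : m * c + x ≤ M.Cf) (hgt : m < M.N → M.Cf < (m + 1 : ℝ) * c + x) :
    M.meanCost c x = ∑ k ∈ Finset.range (m + 1), B M.N M.q k * (k * c + x) +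
      ∑ k ∈ Finset.Ioc m M.N, B M.N M.q k * M.Cf := by
  refine M.meanCost_eq_of_threshold hm (fun k _ hk => ?_) fun k hk hkN => ?_
  · have : (k : ℝ) * c ≤ m * c := mul_le_mul_of_nonneg_right (by exact_mod_cast hk) hc
    linarith
  · have : (m + 1 : ℝ) * c ≤ k * c := mul_le_mul_of_nonneg_right (by exact_mod_cast hk) hc
    linarith [hgt (by omega)]

/-- Where one request already makes fetching optimal. -/
lemma meanCost_gTop {θ c : ℝ} (hc0 : 0 ≤ c) (hc : θ / M.anyRequest ≤ c) :
    M.meanCost c (M.gTop θ) =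
      B M.N M.q 0 * M.gTop θ + ∑ k ∈ Finset.Icc 1 M.N, B M.N M.q k * M.Cf := by
  rw [M.meanCost_eq_of_threshold (Nat.zero_le M.N) (fun k h1 h2 => by omega) fun k hk _ => ?_]
  · simp [← Finset.Icc_add_one_left_eq_Ioc]
  · have h1 : (1 : ℝ) ≤ k := by exact_mod_cast hk
    unfold gTop
    nlinarith

lemma meanCost_gTop_sub {θ c : ℝ} (hc0 : 0 ≤ c) (hc : θ / M.anyRequest ≤ c) :
    M.meanCost c (M.gTop θ) - θ = M.gTop θ := by
  have h := M.sum_B_request_split (Nat.zero_le M.N)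
  rw [zero_add, Finset.sum_range_one, ← Finset.Icc_add_one_left_eq_Ioc, zero_add] at h
  rw [M.meanCost_gTop hc0 hc, ← Finset.sum_mul, eq_sub_of_add_eq' h, B_request_zero, gTop]
  have hβ := M.anyRequest_pos.ne'
  field_simp
  ring

/-- The relative value `g(τ)` of a time `τ` since the last fetch, at the start of a slot: constant
from `tauOne θ` on, and given by the Bellman recursion before. -/
noncomputable def relValue (θ : ℝ) (τ : ℕ) : ℝ :=
  if M.tauOne θ ≤ τ then M.gTop θ else M.meanCost (M.Cav τ) (relValue θ (τ + 1)) - θ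
termination_by M.tauOne θ - τ

lemma relValue_of_tauOne_le {θ : ℝ} {τ : ℕ} (h : M.tauOne θ ≤ τ) :
    M.relValue θ τ = M.gTop θ := by
  rw [relValue, if_pos h]

/-- The constant value is itself a solution of the Bellman recursion, which therefore holds at all
times. -/
lemma relValue_bellman (θ : ℝ) (τ : ℕ) :
    M.relValue θ τ = M.meanCost (M.Cav τ) (M.relValue θ (τ + 1)) - θ := by
  by_cases h : M.tauOne θ ≤ τ
  · rw [M.relValue_of_tauOne_le h, M.relValue_of_tauOne_le (h.trans τ.le_succ)]
    exact (M.meanCost_gTop_sub (M.Cav_nonneg τ)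
      ((M.tauOne_le_iff ((M.tauOne_spec θ).1.trans h)).mp h)).symm
  · rw [relValue, if_neg h]

lemma relValue_mono (θ : ℝ) : Monotone (M.relValue θ) := by
  have key : ∀ n τ : ℕ, M.tauOne θ ≤ τ + n → M.relValue θ τ ≤ M.relValue θ (τ + 1) := by
    intro n
    induction n with
    | zero =>
      intro τ h
      rw [add_zero] at h
      rw [M.relValue_of_tauOne_le h, M.relValue_of_tauOne_le (h.trans τ.le_succ)]
    | succ n ih =>
      intro τ h
      calc M.relValue θ τ = _ := M.relValue_bellman θ τ
        _ ≤ M.meanCost (M.Cav (τ + 1)) (M.relValue θ (τ + 1 + 1)) - θ := ?_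
        _ = _ := (M.relValue_bellman θ (τ + 1)).symm
      exact sub_le_sub_right (M.meanCost_mono (M.Cav_mono τ.le_succ) (ih (τ + 1) (by omega))) _
  exact monotone_nat_of_le_succ fun τ => key (M.tauOne θ) τ (by omega)

lemma relValue_le_gTop (θ : ℝ) (τ : ℕ) : M.relValue θ τ ≤ M.gTop θ :=
  (M.relValue_mono θ (Nat.le_add_right τ (M.tauOne θ))).trans_eq
    (M.relValue_of_tauOne_le (Nat.le_add_left _ _))

lemma relValue_antitone (τ : ℕ) : Antitone fun θ => M.relValue θ τ := by
  intro θ θ' hθ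
  have key : ∀ n τ : ℕ, M.tauOne θ' ≤ τ + n → M.relValue θ' τ ≤ M.relValue θ τ := by
    intro n
    induction n with
    | zero =>
      intro τ h
      rw [add_zero] at h
      rw [M.relValue_of_tauOne_le h, M.relValue_of_tauOne_le ((M.tauOne_mono hθ).trans h)]
      exact M.gTop_antitone hθ
    | succ n ih =>
      intro τ h
      rw [M.relValue_bellman θ τ, M.relValue_bellman θ' τ]
      exact sub_le_sub (M.meanCost_mono le_rfl (ih (τ + 1) (by omega))) hθ
  exact key (M.tauOne θ') τ (by omega)

/-- The number of steps of the recursion is locally bounded in `θ`, and each step is continuous. -/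
lemma continuous_relValue (τ : ℕ) : Continuous fun θ => M.relValue θ τ := by
  have key : ∀ (θ₀ : ℝ) (n τ : ℕ), M.tauOne θ₀ ≤ τ + n →
      ContinuousOn (fun θ => M.relValue θ τ) (Set.Iio θ₀) := by
    intro θ₀ n
    induction n with
    | zero =>
      intro τ h
      have hc : Continuous M.gTop := by unfold gTop; fun_prop
      exact hc.continuousOn.congr fun θ hθ =>
        M.relValue_of_tauOne_le ((M.tauOne_mono (le_of_lt hθ)).trans h)
    | succ n ih =>
      intro τ h
      exact (((M.continuous_meanCost _).comp_continuousOn (ih (τ + 1) (by omega))).sub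
        continuousOn_id).congr fun θ _ => M.relValue_bellman θ τ
  rw [continuous_iff_continuousAt]
  intro θ
  exact (key (θ + 1) (M.tauOne (θ + 1)) τ (by omega)).continuousAt
    (Iio_mem_nhds (lt_add_one θ))

/-! ### Correctness of the algorithm -/

/-- What holds when the outer loop is entered at time `τ`: the current value of `g` is the relative
value, and at time `τ - 1` it is optimal to wait with up to `m` requests. -/
structure LoopInv (θ : ℝ) (τ : ℕ) (s : Vars) : Prop where
  g_eq : s.g τ = M.relValue θ τ
  one_le : 1 ≤ s.m
  le_N : s.m ≤ M.N
  wait : (s.m : ℝ) * M.Cav (τ - 1) + M.relValue θ τ ≤ M.Cf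
  tau_gt : 1 < s.tau s.m

/-- At the end of the inner loop, fetching is optimal with more than `m` requests. -/
lemma innerLoop_spec {θ : ℝ} {τ : ℕ} (hτ : 1 < τ) (s : Vars) (h : M.LoopInv θ τ s) :
    M.LoopInv θ τ (M.innerLoop τ s) ∧
      ((M.innerLoop τ s).m < M.N →
        M.Cf < ((M.innerLoop τ s).m + 1 : ℝ) * M.Cav (τ - 1) + M.relValue θ τ) := by
  induction hn : M.N - s.m generalizing s with
  | zero =>
    have := h.le_N
    rw [innerLoop, if_neg (by omega)]
    exact ⟨h, fun h' => by omega⟩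
  | succ n ih =>
    rw [innerLoop]
    split_ifs with hc
    · refine ih _ ⟨h.g_eq, Nat.le_add_left 1 _, hc.2, ?_, ?_⟩ (by simp only; omega)
      · have := hc.1
        rw [h.g_eq] at this
        push_cast
        linarith
      · simpa using hτ
    · refine ⟨h, fun h' => ?_⟩
      by_contra hcon
      exact hc ⟨by rw [h.g_eq]; linarith, h'⟩

/-- The output of the algorithm in terms of the relative value at time `2`. -/
structure FinalSpec (θ : ℝ) (s : Vars) : Prop where
  g_eq : s.g 2 = M.relValue θ 2
  le_N : s.m ≤ M.N
  wait : (s.m : ℝ) * M.Cav 1 + M.relValue θ 2 ≤ M.Cf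
  fetch : s.m < M.N → M.Cf < (s.m + 1 : ℝ) * M.Cav 1 + M.relValue θ 2
  tau_gt_iff : 1 < s.tau M.N ↔ s.m = M.N

/-- Going back in time keeps waiting optimal with up to `m` requests, because `Cav` and the relative
value both decrease; so `m` never has to be lowered. -/
lemma updateStep_loopInv {θ : ℝ} {τ : ℕ} (hτ : 2 < τ) (s : Vars) (h : M.LoopInv θ τ s)
    (hmax : s.m < M.N → M.Cf < (s.m + 1 : ℝ) * M.Cav (τ - 1) + M.relValue θ τ) :
    M.LoopInv θ (τ - 1) (M.updateStep θ τ s) := by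
  obtain ⟨t, rfl⟩ : ∃ t, τ = t + 1 := ⟨τ - 1, by omega⟩
  simp only [Nat.add_sub_cancel] at hmax ⊢
  have hw := h.wait
  rw [Nat.add_sub_cancel] at hw
  rw [updateStep, if_pos hτ]
  refine ⟨?_, h.one_le, h.le_N, ?_, h.tau_gt⟩
  · simp only [Nat.add_sub_cancel, Function.update_self, h.g_eq]
    rw [M.relValue_bellman θ t,
      M.meanCost_eq_of_maximal (M.Cav_nonneg t) h.le_N hw hmax, ← Finset.sum_mul,
      eq_sub_of_add_eq' (M.sum_B_request_split h.le_N)]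
    have e : ∀ k : ℕ, B M.N M.q k * (k * M.Cav t - M.Cf + M.relValue θ (t + 1)) =
        B M.N M.q k * (k * M.Cav t + M.relValue θ (t + 1)) - B M.N M.q k * M.Cf :=
      fun k => by ring
    simp only [e, Finset.sum_sub_distrib, ← Finset.sum_mul]
    ring
  · have h1 : (s.m : ℝ) * M.Cav (t - 1) ≤ s.m * M.Cav t :=
      mul_le_mul_of_nonneg_left (M.Cav_mono (Nat.sub_le t 1)) (Nat.cast_nonneg _)
    have h2 := M.relValue_mono θ t.le_succ
    simp only
    linarith

lemma updateStep_finalSpec {θ : ℝ} (s : Vars) (h : M.LoopInv θ 2 s)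
    (hmax : s.m < M.N → M.Cf < (s.m + 1 : ℝ) * M.Cav 1 + M.relValue θ 2) :
    M.FinalSpec θ (M.updateStep θ 2 s) := by
  rw [updateStep, if_neg (lt_irrefl 2)]
  refine ⟨h.g_eq, h.le_N, h.wait, hmax, ?_⟩
  have := h.le_N
  simp only
  split_ifs with hc
  · omega
  · have hm : s.m = M.N := by omega
    simpa [hm] using hm ▸ h.tau_gt

lemma outerLoop_finalSpec {θ : ℝ} {τ : ℕ} (hτ : 2 ≤ τ) (s : Vars) (h : M.LoopInv θ τ s) :
    M.FinalSpec θ (M.outerLoop θ τ s) := by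
  induction τ, hτ using Nat.le_induction generalizing s with
  | base =>
    obtain ⟨h1, h2⟩ := M.innerLoop_spec one_lt_two s h
    rw [outerLoop, if_pos one_lt_two, outerLoop, if_neg (by omega)]
    exact M.updateStep_finalSpec _ h1 h2
  | succ τ hτ ih =>
    obtain ⟨h1, h2⟩ := M.innerLoop_spec (by omega) s h
    rw [outerLoop, if_pos (by omega)]
    exact ih _ (M.updateStep_loopInv (by omega) _ h1 h2)

lemma finalVars_spec {θ : ℝ} (h : M.tauOne θ ≠ 1) : M.FinalSpec θ (M.finalVars θ) := by
  have h1 := (M.tauOne_spec θ).1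
  refine M.outerLoop_finalSpec (by omega) _
    ⟨?_, le_rfl, M.N_pos, ?_, ?_⟩
  · simp [M.relValue_of_tauOne_le le_rfl]
  · have hlt : ¬ M.tauOne θ ≤ M.tauOne θ - 1 := by omega
    rw [M.tauOne_le_iff (by omega), not_le] at hlt
    rw [M.relValue_of_tauOne_le le_rfl, gTop]
    push_cast
    linarith
  · simp only [Function.update_self]
    omega

lemma gTwo_eq_relValue (θ : ℝ) : M.gTwo θ = M.relValue θ 2 := by
  unfold gTwo
  split_ifs with h
  · rw [M.relValue_of_tauOne_le (by omega)]
  · exact (M.finalVars_spec h).g_eq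

/-- The map `f` is one more step of the Bellman recursion, without the subtraction of `θ`. -/
lemma f_eq_meanCost (θ : ℝ) : M.f θ = M.meanCost (M.Cav 1) (M.relValue θ 2) := by
  unfold f
  rw [gTwo_eq_relValue]
  split_ifs with h h'
  · rw [M.relValue_of_tauOne_le (by omega),
      M.meanCost_gTop (M.Cav_nonneg 1) ((M.tauOne_le_iff le_rfl).mp h.le)]
  · have hs := M.finalVars_spec h
    rw [M.meanCost_eq_of_maximal (M.Cav_nonneg 1) hs.le_N hs.wait hs.fetch,
      hs.tau_gt_iff.mp h', Finset.Ioc_self, Finset.sum_empty, add_zero]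
    simp only [mul_add, Finset.sum_add_distrib, ← Finset.sum_mul, ← mul_assoc, sum_B, one_mul,
      sum_B_mul_id]
    ring
  · have hs := M.finalVars_spec h
    exact (M.meanCost_eq_of_maximal (M.Cav_nonneg 1) hs.le_N hs.wait hs.fetch).symm

/-! ### The fixed point -/

lemma gTwo_antitone : Antitone M.gTwo := fun _ _ h => by
  rw [gTwo_eq_relValue, gTwo_eq_relValue]
  exact M.relValue_antitone 2 h

lemma f_antitone : Antitone M.f := fun _ _ h => by
  rw [f_eq_meanCost, f_eq_meanCost]
  exact M.meanCost_mono le_rfl (M.relValue_antitone 2 h)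

lemma continuous_f : Continuous M.f := by
  rw [funext M.f_eq_meanCost]
  exact (M.continuous_meanCost _).comp (M.continuous_relValue 2)

lemma f_zero : M.f 0 = M.Cf := by
  have hc : (0 : ℝ) / M.anyRequest ≤ M.Cav 1 := by simpa using M.Cav_nonneg 1
  have h1 : M.tauOne 0 ≤ 2 := ((M.tauOne_le_iff le_rfl).mpr hc).trans one_le_two
  have h := M.meanCost_gTop_sub (M.Cav_nonneg 1) hc
  rw [f_eq_meanCost, M.relValue_of_tauOne_le h1]
  simpa [gTop] using h

/-- Intermediate values on `[0, Cf]`, where `f 0 = Cf` and `f Cf ≤ Cf`. -/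
lemma existsUnique_fixedPoint : ∃! θ : ℝ, M.f θ = θ := by
  have hC : M.f M.Cf ≤ M.Cf := (M.f_antitone M.Cf_nonneg).trans_eq M.f_zero
  obtain ⟨θ, -, hθ⟩ := intermediate_value_Icc' M.Cf_nonneg
    ((M.continuous_f.sub continuous_id).continuousOn)
    (show (0 : ℝ) ∈ Set.Icc (M.f M.Cf - M.Cf) (M.f 0 - 0) from
      ⟨sub_nonpos.mpr hC, by rw [f_zero, sub_zero]; exact M.Cf_nonneg⟩)
  have hθ' : M.f θ = θ := sub_eq_zero.mp hθ
  refine ⟨θ, hθ', fun θ' h => ?_⟩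
  rcases le_total θ θ' with hl | hl
  · linarith [M.f_antitone hl, show M.f θ' = θ' from h]
  · linarith [M.f_antitone hl, show M.f θ' = θ' from h]

lemma fixedPoint_nonneg {θ : ℝ} (h : M.f θ = θ) : 0 ≤ θ := by
  by_contra! hlt
  linarith [M.f_antitone hlt.le, M.f_zero, M.Cf_nonneg]

/-- At a fixed point the relative value of a fresh copy vanishes. -/
lemma relValue_one_of_fixedPoint {θ : ℝ} (h : M.f θ = θ) : M.relValue θ 1 = 0 := by
  rw [M.relValue_bellman, ← M.f_eq_meanCost, h, sub_self]

end Model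

/-! ### Expectations under finitely supported laws -/

/-- The expectation of `φ` under `μ`. It is a finite sum for the finitely supported laws to which it
is applied. -/
noncomputable def mean {α : Type*} (μ : PMF α) (φ : α → ℝ) : ℝ := ∑' x, (μ x).toReal * φ x

section Mean

variable {α γ : Type*}

lemma mean_eq_sum (μ : PMF α) (φ : α → ℝ) {s : Finset α} (hs : μ.support ⊆ s) :
    mean μ φ = ∑ x ∈ s, (μ x).toReal * φ x := by
  refine tsum_eq_sum fun x hx => ?_
  have : μ x = 0 := by
    by_contra h
    exact hx (hs ((μ.mem_support_iff x).mpr h))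
  simp [this]

lemma mean_pure (a : α) (φ : α → ℝ) : mean (PMF.pure a) φ = φ a := by
  rw [mean_eq_sum (s := {a}) _ _ (by simp)]
  simp

lemma mean_bind {μ : PMF α} {κ : α → PMF γ} (hμ : μ.support.Finite)
    (hκ : ∀ x, (κ x).support.Finite) (φ : γ → ℝ) :
    mean (μ.bind κ) φ = mean μ fun x => mean (κ x) φ := by
  classical
  set s := hμ.toFinset
  have hs : μ.support ⊆ s := by simp [s]
  set t := s.biUnion fun x => (hκ x).toFinset
  have ht : ∀ x ∈ s, (κ x).support ⊆ t := fun x hx y hy => by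
    simp only [t, Finset.coe_biUnion, Set.mem_iUnion]
    exact ⟨x, hx, by simpa using hy⟩
  have hb : (μ.bind κ).support ⊆ t := by
    rw [PMF.support_bind]
    exact Set.iUnion₂_subset fun x hx => ht x (hs hx)
  have hval : ∀ y, (μ.bind κ y).toReal = ∑ x ∈ s, (μ x).toReal * (κ x y).toReal := by
    intro y
    rw [PMF.bind_apply, tsum_eq_sum (s := s) fun x hx => ?_, ENNReal.toReal_sum fun x _ =>
      ENNReal.mul_ne_top (μ.apply_ne_top x) ((κ x).apply_ne_top y)]
    · simp only [ENNReal.toReal_mul]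
    · have : μ x = 0 := by
        by_contra h
        exact hx (hs ((μ.mem_support_iff x).mpr h))
      simp [this]
  rw [mean_eq_sum _ _ hb, mean_eq_sum _ _ hs]
  simp only [hval, Finset.sum_mul]
  rw [Finset.sum_comm]
  refine Finset.sum_congr rfl fun x hx => ?_
  rw [mean_eq_sum _ _ (ht x hx), Finset.mul_sum]
  exact Finset.sum_congr rfl fun y _ => by ring

lemma mean_map {μ : PMF α} (hμ : μ.support.Finite) (f : α → γ) (φ : γ → ℝ) :
    mean (μ.map f) φ = mean μ fun x => φ (f x) := by
  rw [PMF.map, mean_bind hμ fun x => by simp]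
  simp [mean_pure]

lemma mean_mono {μ : PMF α} (hμ : μ.support.Finite) {φ ψ : α → ℝ} (h : ∀ x, φ x ≤ ψ x) :
    mean μ φ ≤ mean μ ψ := by
  rw [mean_eq_sum _ _ (s := hμ.toFinset) (by simp), mean_eq_sum _ _ (s := hμ.toFinset) (by simp)]
  exact Finset.sum_le_sum fun x _ => mul_le_mul_of_nonneg_left (h x) ENNReal.toReal_nonneg

lemma mean_add {μ : PMF α} (hμ : μ.support.Finite) (φ ψ : α → ℝ) :
    mean μ (fun x => φ x + ψ x) = mean μ φ + mean μ ψ := by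
  have hs : μ.support ⊆ hμ.toFinset := by simp
  simp only [mean_eq_sum _ _ hs, mul_add, Finset.sum_add_distrib]

lemma mean_const {μ : PMF α} (hμ : μ.support.Finite) (c : ℝ) : mean μ (fun _ => c) = c := by
  have hs : μ.support ⊆ hμ.toFinset := by simp
  rw [mean_eq_sum _ _ hs, ← Finset.sum_mul, ← ENNReal.toReal_sum fun x _ => μ.apply_ne_top x]
  have h1 : ∑ x ∈ hμ.toFinset, μ x = 1 := by
    rw [← μ.tsum_coe]
    refine (tsum_eq_sum fun x hx => ?_).symm
    by_contra h
    exact hx (by simpa using h)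
  simp [h1]

end Mean

namespace Model

variable (M : Model)

/-! ### One slot of the process -/

lemma finite_support_historyLaw (π : M.Policy) (s₀ : M.State) (t : ℕ) :
    (M.historyLaw π s₀ t).support.Finite := by
  induction t with
  | zero => simp [historyLaw]
  | succ t ih =>
    rw [historyLaw, PMF.support_bind]
    refine ih.biUnion fun x _ => ?_
    rw [PMF.support_bind]
    refine (Set.toFinite _).biUnion fun a _ => ?_
    rw [PMF.support_map]
    exact (Set.toFinite _).image _

lemma mean_requestLaw (φ : ℕ → ℝ) :
    mean M.requestLaw (fun k => φ k) = ∑ k ∈ Finset.range (M.N + 1), B M.N M.q k * φ k := by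
  rw [mean_eq_sum _ _ (s := Finset.univ) (by simp),
    ← Fin.sum_univ_eq_sum_range fun k => B M.N M.q k * φ k]
  refine Finset.sum_congr rfl fun k _ => ?_
  rw [requestLaw, PMF.ofFintype_apply, ENNReal.toReal_ofReal (M.B_request_nonneg k)]

lemma expectedCost_eq (π : M.Policy) (s₀ : M.State) (t : ℕ) :
    M.expectedCost π s₀ t = mean (M.historyLaw π s₀ t) fun x =>
      mean (π x.1 x.2) fun a => M.stageCost x.2 a := by
  change mean (M.stateActionLaw π s₀ t) (fun y => M.stageCost y.1 y.2) = _
  rw [stateActionLaw, mean_bind (M.finite_support_historyLaw π s₀ t) fun x => ?_]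
  · simp only [mean_map (Set.toFinite _)]
  · rw [PMF.support_map]
    exact (Set.toFinite _).image _

lemma mean_historyLaw_succ (π : M.Policy) (s₀ : M.State) (t : ℕ) (φ : M.State → ℝ) :
    mean (M.historyLaw π s₀ (t + 1)) (fun x => φ x.2) =
      mean (M.historyLaw π s₀ t) fun x => mean (π x.1 x.2) fun a =>
        mean M.requestLaw fun k => φ (if a then 1 else x.2.1 + 1, k) := by
  have hmap : ∀ (x : M.Past × M.State) (a : Bool),
      (M.requestLaw.map fun k => ((x.2, a) :: x.1,
        ((if a then 1 else x.2.1 + 1, k) : M.State))).support.Finite := fun x a => by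
    rw [PMF.support_map]
    exact (Set.toFinite _).image _
  rw [historyLaw, mean_bind (M.finite_support_historyLaw π s₀ t) fun x => ?_]
  · congr 1
    funext x
    rw [mean_bind (Set.toFinite _) (hmap x)]
    simp only [mean_map (Set.toFinite _)]
  · rw [PMF.support_bind]
    exact (Set.toFinite _).biUnion fun a _ => hmap x a

/-! ### The average cost optimality equation -/

/-- The relative cost of a state `(τ, m)`: the value of `m` requests at time `τ` when waiting leads
to the relative value of time `τ + 1`. -/
noncomputable def stateValue (θ : ℝ) (s : M.State) : ℝ :=
  M.slotCost (M.Cav s.1) (M.relValue θ (s.1 + 1)) (s.2 : ℕ)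

/-- The action that attains the minimum in the optimality equation. -/
noncomputable def greedyAction (θ : ℝ) (s : M.State) : Bool :=
  decide ((s.2 : ℕ) ≠ 0 ∧
    M.Cf ≤ ((s.2 : ℕ) : ℝ) * M.Cav s.1 + M.relValue θ (s.1 + 1))

/-- The stationary policy of greedy actions. -/
noncomputable def greedyPolicy (θ : ℝ) : M.Policy := fun _ s => PMF.pure (M.greedyAction θ s)

lemma mean_stateValue (θ : ℝ) (τ : ℕ) :
    mean M.requestLaw (fun k => M.stateValue θ (τ, k)) = M.relValue θ τ + θ := by
  rw [M.relValue_bellman, sub_add_cancel]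
  exact M.mean_requestLaw fun k => M.slotCost (M.Cav τ) (M.relValue θ (τ + 1)) k

/-- Averaging out the next number of requests, which is independent of the past, turns the relative
cost of the next state into the relative value of the next time, up to `θ`. -/
lemma mean_stateValue_succ (θ : ℝ) (π : M.Policy) (s₀ : M.State) (t : ℕ) :
    M.expectedCost π s₀ t + mean (M.historyLaw π s₀ (t + 1)) (fun x => M.stateValue θ x.2) =
      mean (M.historyLaw π s₀ t) (fun x => mean (π x.1 x.2) fun a =>
        M.stageCost x.2 a + M.relValue θ (if a then 1 else x.2.1 + 1)) + θ := by
  have hf := M.finite_support_historyLaw π s₀ t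
  rw [M.mean_historyLaw_succ π s₀ t (M.stateValue θ), expectedCost_eq, ← mean_add hf]
  simp only [mean_stateValue, ← mean_add (Set.toFinite _)]
  simp only [← add_assoc, mean_add (Set.toFinite _) _ (fun _ => θ), mean_const (Set.toFinite _),
    mean_add hf _ (fun _ => θ), mean_const hf]


lemma relValue_le_Cf {θ : ℝ} (h : M.f θ = θ) (τ : ℕ) : M.relValue θ τ ≤ M.Cf :=
  (M.relValue_le_gTop θ τ).trans
    (sub_le_self _ (div_nonneg (M.fixedPoint_nonneg h) M.anyRequest_pos.le))

lemma relValue_succ_nonneg {θ : ℝ} (h : M.f θ = θ) (τ : ℕ) : 0 ≤ M.relValue θ (τ + 1) :=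
  (M.relValue_one_of_fixedPoint h).symm.trans_le (M.relValue_mono θ (Nat.le_add_left 1 τ))

lemma stateValue_nonneg {θ : ℝ} (h : M.f θ = θ) (s : M.State) : 0 ≤ M.stateValue θ s := by
  have h1 := M.relValue_succ_nonneg h s.1
  unfold stateValue slotCost
  split_ifs
  · exact h1
  · exact le_min M.Cf_nonneg (add_nonneg (mul_nonneg (Nat.cast_nonneg _) (M.Cav_nonneg _)) h1)

lemma stateValue_le_Cf {θ : ℝ} (h : M.f θ = θ) (s : M.State) : M.stateValue θ s ≤ M.Cf := by
  unfold stateValue slotCost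
  split_ifs
  · exact M.relValue_le_Cf h _
  · exact min_le_left _ _

/-- The optimality inequality, for every action. -/
lemma stateValue_le {θ : ℝ} (h : M.f θ = θ) (s : M.State) (a : Bool) :
    M.stateValue θ s ≤ M.stageCost s a + M.relValue θ (if a then 1 else s.1 + 1) := by
  cases a with
  | true =>
    simpa [stageCost, M.relValue_one_of_fixedPoint h] using M.stateValue_le_Cf h s
  | false =>
    simp only [stageCost, stateValue, slotCost, Bool.false_eq_true, if_false]
    split_ifs with h0
    · simp [h0]
    · exact min_le_right _ _

lemma stateValue_eq_greedy {θ : ℝ} (h : M.f θ = θ) (s : M.State) :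
    M.stateValue θ s = M.stageCost s (M.greedyAction θ s) +
      M.relValue θ (if M.greedyAction θ s then 1 else s.1 + 1) := by
  by_cases hg : (s.2 : ℕ) ≠ 0 ∧ M.Cf ≤ ((s.2 : ℕ) : ℝ) * M.Cav s.1 + M.relValue θ (s.1 + 1)
  · have ha : M.greedyAction θ s = true := decide_eq_true hg
    rw [ha, stateValue, slotCost, if_neg hg.1, min_eq_left hg.2]
    simp [stageCost, M.relValue_one_of_fixedPoint h]
  · have ha : M.greedyAction θ s = false := decide_eq_false hg
    rw [ha]
    simp only [stageCost, stateValue, slotCost, Bool.false_eq_true, if_false]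
    split_ifs with h0
    · simp [h0]
    · exact min_eq_right (le_of_not_ge fun hc => hg ⟨h0, hc⟩)

/-! ### The optimal average cost -/

lemma mean_stateValue_mem {θ : ℝ} (h : M.f θ = θ) (π : M.Policy) (s₀ : M.State) (t : ℕ) :
    mean (M.historyLaw π s₀ t) (fun x => M.stateValue θ x.2) ∈ Set.Icc 0 M.Cf := by
  have hf := M.finite_support_historyLaw π s₀ t
  constructor
  · rw [← mean_const hf 0]
    exact mean_mono hf fun x => M.stateValue_nonneg h x.2
  · refine (mean_mono hf fun x => M.stateValue_le_Cf h x.2).trans_eq (mean_const hf _)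

/-- The optimality inequality telescopes over the slots, and the relative cost is bounded. -/
lemma le_sum_expectedCost {θ : ℝ} (h : M.f θ = θ) (π : M.Policy) (s₀ : M.State) (T : ℕ) :
    T * θ - M.Cf ≤ ∑ t ∈ Finset.range T, M.expectedCost π s₀ t := by
  have hstep : ∀ t, θ + mean (M.historyLaw π s₀ t) (fun x => M.stateValue θ x.2) ≤
      M.expectedCost π s₀ t + mean (M.historyLaw π s₀ (t + 1)) (fun x => M.stateValue θ x.2) := by
    intro t
    rw [mean_stateValue_succ, add_comm]
    gcongr
    refine mean_mono (M.finite_support_historyLaw π s₀ t) fun x => ?_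
    rw [← mean_const (Set.toFinite (π x.1 x.2).support) (M.stateValue θ x.2)]
    exact mean_mono (Set.toFinite _) fun a => M.stateValue_le h x.2 a
  have key : T * θ + mean (M.historyLaw π s₀ 0) (fun x => M.stateValue θ x.2) ≤
      ∑ t ∈ Finset.range T, M.expectedCost π s₀ t +
        mean (M.historyLaw π s₀ T) (fun x => M.stateValue θ x.2) := by
    induction T with
    | zero => simp
    | succ T ih =>
      rw [Finset.sum_range_succ]
      push_cast
      linarith [hstep T]
  linarith [(M.mean_stateValue_mem h π s₀ 0).1, (M.mean_stateValue_mem h π s₀ T).2]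

lemma sum_expectedCost_greedy_le {θ : ℝ} (h : M.f θ = θ) (s₀ : M.State) (T : ℕ) :
    ∑ t ∈ Finset.range T, M.expectedCost (M.greedyPolicy θ) s₀ t ≤ T * θ + M.Cf := by
  have hstep : ∀ t, M.expectedCost (M.greedyPolicy θ) s₀ t +
      mean (M.historyLaw (M.greedyPolicy θ) s₀ (t + 1)) (fun x => M.stateValue θ x.2) =
        θ + mean (M.historyLaw (M.greedyPolicy θ) s₀ t) (fun x => M.stateValue θ x.2) := by
    intro t
    rw [mean_stateValue_succ, add_comm]
    simp only [greedyPolicy, mean_pure, ← M.stateValue_eq_greedy h]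
  have key : ∑ t ∈ Finset.range T, M.expectedCost (M.greedyPolicy θ) s₀ t +
      mean (M.historyLaw (M.greedyPolicy θ) s₀ T) (fun x => M.stateValue θ x.2) =
        T * θ + mean (M.historyLaw (M.greedyPolicy θ) s₀ 0) (fun x => M.stateValue θ x.2) := by
    induction T with
    | zero => simp
    | succ T ih =>
      rw [Finset.sum_range_succ]
      push_cast
      linarith [hstep T]
  linarith [(M.mean_stateValue_mem h (M.greedyPolicy θ) s₀ 0).2,
    (M.mean_stateValue_mem h (M.greedyPolicy θ) s₀ T).1]

lemma tendsto_add_div (θ c : ℝ) : Tendsto (fun T : ℕ => θ + c / T) atTop (𝓝 θ) := by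
  simpa using tendsto_const_nhds.add (tendsto_const_div_atTop_nhds_zero_nat c)

lemma le_averageCost {θ : ℝ} (h : M.f θ = θ) (π : M.Policy) (s₀ : M.State) {T : ℕ} (hT : 0 < T) :
    θ + -M.Cf / T ≤ M.averageCost π s₀ T := by
  have hT' : (0 : ℝ) < T := by exact_mod_cast hT
  rw [averageCost, le_div_iff₀ hT', add_mul, div_mul_cancel₀ _ hT'.ne']
  linarith [M.le_sum_expectedCost h π s₀ T]

lemma tendsto_averageCost_greedy {θ : ℝ} (h : M.f θ = θ) (s₀ : M.State) :
    Tendsto (M.averageCost (M.greedyPolicy θ) s₀) atTop (𝓝 θ) := by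
  refine tendsto_of_tendsto_of_tendsto_of_le_of_le' (tendsto_add_div θ (-M.Cf))
    (tendsto_add_div θ M.Cf) ?_ ?_
  · filter_upwards [eventually_gt_atTop 0] with T hT using M.le_averageCost h _ s₀ hT
  · filter_upwards [eventually_gt_atTop 0] with T hT
    have hT' : (0 : ℝ) < T := by exact_mod_cast hT
    rw [averageCost, div_le_iff₀ hT', add_mul, div_mul_cancel₀ _ hT'.ne']
    linarith [M.sum_expectedCost_greedy_le h s₀ T]

lemma isOptimalAverageCost_of_fixedPoint {θ : ℝ} (h : M.f θ = θ) : M.IsOptimalAverageCost θ := by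
  refine fun s₀ _ => ⟨fun π => ?_, M.greedyPolicy θ, M.tendsto_averageCost_greedy h s₀⟩
  have hlim : Tendsto (fun T : ℕ => ((θ + -M.Cf / T : ℝ) : EReal)) atTop (𝓝 (θ : EReal)) :=
    (continuous_coe_real_ereal.tendsto θ).comp (tendsto_add_div θ (-M.Cf))
  rw [← hlim.liminf_eq]
  refine liminf_le_liminf ?_
  filter_upwards [eventually_gt_atTop 0] with T hT
  exact EReal.coe_le_coe_iff.mpr (M.le_averageCost h π s₀ hT)

lemma IsOptimalAverageCost.le {M : Model} {θ θ' : ℝ} (h : M.IsOptimalAverageCost θ)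
    (h' : M.IsOptimalAverageCost θ') : θ ≤ θ' := by
  obtain ⟨π, hπ⟩ := (h' (1, 0) le_rfl).2
  have hle := (h (1, 0) le_rfl).1 π
  have hlim : Tendsto (fun T => ((M.averageCost π (1, 0) T : ℝ) : EReal)) atTop (𝓝 (θ' : EReal)) :=
    (continuous_coe_real_ereal.tendsto θ').comp hπ
  exact EReal.coe_le_coe_iff.mp (hle.trans_eq hlim.liminf_eq)

end Model

end ContentFetching

theorem theorem2 (M : ContentFetching.Model) :
    Antitone M.gTwo ∧ Antitone M.f ∧
      (∃! θ : ℝ, M.f θ = θ) ∧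
      ∀ θ : ℝ, M.f θ = θ ↔ M.IsOptimalAverageCost θ := by
  refine ⟨M.gTwo_antitone, M.f_antitone, M.existsUnique_fixedPoint,
    fun θ => ⟨M.isOptimalAverageCost_of_fixedPoint, fun h => ?_⟩⟩
  obtain ⟨θ', hθ', -⟩ := M.existsUnique_fixedPoint
  have h' := M.isOptimalAverageCost_of_fixedPoint hθ'
  rwa [le_antisymm (h.le h') (h'.le h)]
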